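/- Let $n,d,r,p\ge 0$ and $l\ge 1$ be integers, let $c_t\in\mathbb{R}^r$, $\tau_t\in\mathbb{R}$ for $t=1,\dots,p$, and let $Z=\{y\in\mathbb{R}^r:\langle c_t,y\rangle\le\tau_t,\ t=1,\dots,p\}$. Let $\varphi_1,\dots,\varphi_l,\zeta_1,\dots,\zeta_r:\mathbb{R}^n\times\mathbb{R}^d\to\mathbb{R}$ be $\mathcal{C}^2$-smooth around $(\bar x,\bar w)$. Put $\Xi=(\varphi_1,\dots,\varphi_l)$, $\Upsilon=(\zeta_1,\dots,\zeta_r)$, and suppose that $\bar x$ is feasible, i.e. $\Upsilon(\bar x,\bar w)\in Z$, for the constrained minimax problem $$\text{minimize}\quad \max\{\varphi_1(x,\bar w),\dots,\varphi_l(x,\bar w)\}+\delta(\Upsilon(x,\bar w);Z)-\langle v,x\rangle,\qquad x\in\mathbb{R}^n,$$ where $\delta(\cdot;Z)$ is $0$ on $Z$ and $\infty$ elsewhere. With $m=l+r$ this problem is in the composite form of minimizing $\theta(\Phi(x,\bar w))-\langle v,x\rangle$, where $\Phi=(\Xi,\Upsilon)$ takes values in $\mathbb{R}^{l+r}=\mathbb{R}^m$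 and $$\theta(z)=\max_{1\le i\le l}\langle (e_i,0),z\rangle+\delta\big(z;\{z\in\mathbb{R}^{m}:\langle(0,c_t),z\rangle\le\tau_t,\ t=1,\dots,p\}\big),$$ with $e_i$ the unit vectors of $\mathbb{R}^l$. Let $\bar z_1=\Xi(\bar x,\bar w)$, $\bar z_2=\Upsilon(\bar x,\bar w)$, $\bar z=(\bar z_1,\bar z_2)$. Let $\partial\theta(\bar z)$ be the limiting (Mordukhovich) subdifferential, i.e. the set of $v\in\mathbb{R}^m$ such that $(v,-1)$ is a limiting normal to $\mathrm{epi}\,\theta$ at $(\bar z,\theta(\bar z))$. Let $S(\bar z)$ be the linear subspace parallel to the affine hull of $\partial\theta(\bar z)$, and $s=\dim S(\bar z)$. Call an $s\times m$ matrix $B$ a reduction matrix if there is an orthogonal $m\times m$ matrix $A$ with $A^*(S(\bar z))=\mathbb{R}^s\times\{0\}\subset\mathbb{R}^s\times\mathbb{R}^{m-s}$ such that $B$ is obtained from $A^{-1}$ by deleting its last $m-s$ rows. The nondegeneracy condition ND for $B$ says that $(\bar x,\bar w)$ is a partial nondegenerate point of $\Phi$ in $x$ relative to $h(z)=Bz$,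 i.e. $$\nabla_x\Phi(\bar x,\bar w)\mathbb{R}^n+\ker\nabla h(\bar z)=\mathbb{R}^m .$$ Then reduction matrices exist, and for every reduction matrix $B$ the condition ND is equivalent to $$\mathcal{D}\cap\ker\big(\nabla_x\Xi(\bar x,\bar w)^*,\nabla_x\Upsilon(\bar x,\bar w)^*\big)=\{0\},$$ where the kernel is that of $(y_1,y_2)\mapsto\nabla_x\Xi(\bar x,\bar w)^*y_1+\nabla_x\Upsilon(\bar x,\bar w)^*y_2$ and $$\mathcal{D}=\big\{(y_1,y_2)\in\mathbb{R}^l\times\mathbb{R}^r:\ y_1\in\mathrm{span}\{e_i-e_j: i,j\in\mathcal{K}\},\ y_2\in\mathrm{span}\{c_t: t\in\mathcal{I}\}\big\},$$ $$\mathcal{K}=\Big\{i:\ \varphi_i(\bar x,\bar w)=\max_{1\le j\le l}\varphi_j(\bar x,\bar w)\Big\},\qquad \mathcal{I}=\{t:\ \langle c_t,\bar z_2\rangle=\tau_t\}.$$ -/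

import Mathlib

open Filter Topology

noncomputable section

namespace MinimaxND

/-- The Euclidean space of dimension `n`. -/
abbrev Vec (n : ℕ) : Type := EuclideanSpace ℝ (Fin n)

/-! ### Limiting normals and subgradients -/

/-- `v` is a regular (Fréchet) normal to `Ω` at `x`: the upper limit of
`⟪v, y - x⟫ / ‖y - x‖`, as `y → x` within `Ω`, is at most zero. -/
def IsRegularNormal {F : Type*} [NormedAddCommGroup F] [InnerProductSpace ℝ F]
    (Ω : Set F) (x v : F) : Prop :=
  ∀ ε : ℝ, 0 < ε → ∀ᶠ y in 𝓝[Ω] x, inner ℝ v (y - x) ≤ ε * ‖y - x‖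

/-- The limiting (basic, Mordukhovich) normal cone to `Ω` at `x`
(empty when `x` does not belong to `Ω`). -/
def limitingNormalCone {F : Type*} [NormedAddCommGroup F] [InnerProductSpace ℝ F]
    (Ω : Set F) (x : F) : Set F :=
  {v | x ∈ Ω ∧ ∃ (xs vs : ℕ → F), Tendsto xs atTop (𝓝 x) ∧ Tendsto vs atTop (𝓝 v) ∧
    ∀ k, xs k ∈ Ω ∧ IsRegularNormal Ω (xs k) (vs k)}

/-- The epigraph of an extended-real-valued function, as a subset of the Euclidean
product of `Vec m` with the real line. -/
def epigraph {m : ℕ} (θ : Vec m → EReal) : Set (WithLp 2 (Vec m × ℝ)) :=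
  {q | θ q.fst ≤ (q.snd : EReal)}

/-- The limiting subdifferential of `θ` at `z`, through normals to the epigraph
(empty where `θ` is not finite). -/
def subdifferential {m : ℕ} (θ : Vec m → EReal) (z : Vec m) : Set (Vec m) :=
  {v | θ z ≠ ⊤ ∧ θ z ≠ ⊥ ∧
    WithLp.toLp 2 (v, (-1 : ℝ)) ∈
      limitingNormalCone (epigraph θ) (WithLp.toLp 2 (z, (θ z).toReal))}

/-- The linear subspace parallel to the affine hull of the subdifferential of `θ` at `z`. -/
def parallelSubspace {m : ℕ} (θ : Vec m → EReal) (z : Vec m) : Submodule ℝ (Vec m) :=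
  (affineSpan ℝ (subdifferential θ z)).direction

/-! ### The nondegeneracy condition ND -/

/-- The subspace of vectors whose coordinates after the first `s` ones vanish. -/
def leadingCoordinates (m s : ℕ) : Submodule ℝ (Vec m) where
  carrier := {y | ∀ i : Fin m, s ≤ (i : ℕ) → y i = 0}
  add_mem' := by
    intro a b ha hb i hi
    simp [ha i hi, hb i hi]
  zero_mem' := by
    intro i _
    simp
  smul_mem' := by
    intro c a ha i hi
    simp [ha i hi]

/-- `B` is a reduction matrix of `θ` at `z`. With `S` the subspace parallel to the affine hull
of the subdifferential and `s = dim S`, there is an orthogonal matrix `A` whose transpose maps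
`S` onto the subspace of the first `s` coordinates, and `B` is obtained from `A⁻¹` by deleting
its last `m - s` rows. -/
def IsReductionMatrix {m : ℕ} (θ : Vec m → EReal) (z : Vec m)
    (B : Matrix (Fin (Module.finrank ℝ (parallelSubspace θ z))) (Fin m) ℝ) : Prop :=
  ∃ (A : Matrix (Fin m) (Fin m) ℝ) (hs : Module.finrank ℝ (parallelSubspace θ z) ≤ m),
    A ∈ Matrix.orthogonalGroup (Fin m) ℝ ∧
    (parallelSubspace θ z).map (Matrix.toEuclideanLin A.transpose) =
      leadingCoordinates m (Module.finrank ℝ (parallelSubspace θ z)) ∧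
    B = A⁻¹.submatrix (Fin.castLE hs) id

/-- The partial derivative in the first variable. -/
def partialFDeriv {n d m : ℕ} (Φ : Vec n → Vec d → Vec m) (x : Vec n) (w : Vec d) :
    Vec n →L[ℝ] Vec m :=
  fderiv ℝ (fun u => Φ u w) x

/-- `(x, w)` is a partial nondegenerate point of `Φ` in `x` relative to `h`. -/
def IsPartialNondegenerate {n d m s : ℕ} (Φ : Vec n → Vec d → Vec m) (h : Vec m → Vec s)
    (x : Vec n) (w : Vec d) : Prop :=
  LinearMap.range (partialFDeriv Φ x w : Vec n →ₗ[ℝ] Vec m) ⊔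
    LinearMap.ker (fderiv ℝ h (Φ x w) : Vec m →ₗ[ℝ] Vec s) = ⊤

/-! ### The constrained minimax problem and its composite form -/

/-- The pair `(y₁, y₂)` as a vector with `l + r` coordinates. -/
def pair {l r : ℕ} (y₁ : Vec l) (y₂ : Vec r) : Vec (l + r) :=
  WithLp.toLp 2 (Fin.append y₁.ofLp y₂.ofLp)

/-- The mapping with given real-valued components. -/
def stack {n d k : ℕ} (f : Fin k → Vec n → Vec d → ℝ) (x : Vec n) (w : Vec d) : Vec k :=
  WithLp.toLp 2 (fun i => f i x w)

/-- The maximum of a nonempty finite family of real numbers. -/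
def finMax {l : ℕ} [NeZero l] (f : Fin l → ℝ) : ℝ :=
  Finset.univ.sup' Finset.univ_nonempty f

/-- The polyhedron of the solutions `y` of `⟪c t, y⟫ ≤ τ t` for all `t`. -/
def polyhedron {k p : ℕ} (c : Fin p → Vec k) (τ : Fin p → ℝ) : Set (Vec k) :=
  {y | ∀ t, inner ℝ (c t) y ≤ τ t}

open Classical in
/-- The indicator function of a set: zero on the set and `∞` outside. -/
def indicatorFn {k : ℕ} (Z : Set (Vec k)) (y : Vec k) : EReal :=
  if y ∈ Z then 0 else ⊤

/-- The outer function `max {⟪a i, z⟫} + δ(z; {z | ⟪d t, z⟫ ≤ τ t for all t})` of the composite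
form, with `a i = (e i, 0)` and `d t = (0, c t)`. -/
def minimaxOuter {l r p : ℕ} [NeZero l] (c : Fin p → Vec r) (τ : Fin p → ℝ)
    (z : Vec (l + r)) : EReal :=
  (finMax (fun i : Fin l => inner ℝ (pair (EuclideanSpace.single i (1 : ℝ)) (0 : Vec r)) z) :
      EReal) +
    indicatorFn (polyhedron (fun t => pair (0 : Vec l) (c t)) τ) z

/-- The inner mapping `(Ξ, Υ)` of the composite form, where `Ξ` has the components `φ i` and
`Υ` the components `ζ j`. -/
def minimaxInner {n d l r : ℕ} (φ : Fin l → Vec n → Vec d → ℝ) (ζ : Fin r → Vec n → Vec d → ℝ)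
    (x : Vec n) (w : Vec d) : Vec (l + r) :=
  pair (stack φ x w) (stack ζ x w)

/-- The indices at which the maximum of the coordinates of `z₁` is attained. -/
def activeMax {l : ℕ} [NeZero l] (z₁ : Vec l) : Set (Fin l) :=
  {i | finMax (fun j => z₁ j) = z₁ i}

/-- The indices of the constraints that are active at `z₂`. -/
def activeConstraints {r p : ℕ} (c : Fin p → Vec r) (τ : Fin p → ℝ) (z₂ : Vec r) :
    Set (Fin p) :=
  {t | inner ℝ (c t) z₂ = τ t}

/-- The set of the pairs `(y₁, y₂)` with `y₁` in the span of the differences of unit vectors over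
active indices of the maximum, and `y₂` in the span of the active constraint vectors. -/
def activeSpan {l r p : ℕ} [NeZero l] (c : Fin p → Vec r) (τ : Fin p → ℝ)
    (z₁ : Vec l) (z₂ : Vec r) : Set (Vec l × Vec r) :=
  {y | y.1 ∈ Submodule.span ℝ {u : Vec l | ∃ i ∈ activeMax z₁, ∃ j ∈ activeMax z₁,
        u = EuclideanSpace.single i (1 : ℝ) - EuclideanSpace.single j (1 : ℝ)} ∧
      y.2 ∈ Submodule.span ℝ {u : Vec r | ∃ t ∈ activeConstraints c τ z₂, u = c t}}

/-- The kernel of `(∇ₓΞ(x, w)*, ∇ₓΥ(x, w)*)`, that is, of the mapping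
`(y₁, y₂) ↦ ∇ₓΞ(x, w)* y₁ + ∇ₓΥ(x, w)* y₂`. -/
def adjointKernel {n d l r : ℕ} (Ξ : Vec n → Vec d → Vec l) (Υ : Vec n → Vec d → Vec r)
    (x : Vec n) (w : Vec d) : Set (Vec l × Vec r) :=
  {y | ContinuousLinearMap.adjoint (partialFDeriv Ξ x w) y.1 +
        ContinuousLinearMap.adjoint (partialFDeriv Υ x w) y.2 = 0}

end MinimaxND

end

open MinimaxND

namespace MinimaxND

/-! The heart is the identity `S = maxSpan × constraintSpan` for the space parallel to the affine
hull of the subdifferential (`parallelSubspace_minimaxOuter`). It is proved without computing the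
subdifferential.

For ⊇, the subgradients `(eᵢ, 0)` and `(eᵢ, c t)`, with `i` and `t` active, have differences that
span the right side. For ⊆, take a direction `(u₁, u₂)` with `u₁` constantly `κ` on the active
indices and `u₂` orthogonal to the active `c t`. Near the base point the epigraph can be followed
both ways along `(u₁, u₂, κ)`. Nearby regular normals are therefore orthogonal to that vector, and
so are their limits. Hence every subgradient pairs to `κ` with `(u₁, u₂)`
(`inner_eq_of_mem_subdifferential`), and taking orthogonal complements twice gives the inclusion.

The rest is linear algebra: every reduction matrix has kernel `Sᗮ` (`ker_reductionMatrix`), and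
`range T + Sᗮ` is the whole space exactly when `S` meets the kernel of the adjoint of `T` trivially.
-/

/-! ### Regular normals and global subgradients -/

/-- A regular normal makes no acute angle with a direction along which the set extends. -/
theorem IsRegularNormal.inner_nonpos {F : Type*} [NormedAddCommGroup F] [InnerProductSpace ℝ F]
    {Ω : Set F} {x v u : F} (h : IsRegularNormal Ω x v)
    (hu : ∀ᶠ t : ℝ in 𝓝[>] 0, x + t • u ∈ Ω) : inner ℝ v u ≤ 0 := by
  have key : ∀ ε : ℝ, 0 < ε → inner ℝ v u ≤ ε * ‖u‖ := by
    intro ε hε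
    have htend : Tendsto (fun t : ℝ => x + t • u) (𝓝[>] 0) (𝓝[Ω] x) := by
      refine tendsto_nhdsWithin_iff.2 ⟨?_, hu⟩
      have : Tendsto (fun t : ℝ => x + t • u) (𝓝 0) (𝓝 (x + (0 : ℝ) • u)) :=
        Continuous.tendsto (by fun_prop) 0
      simpa using this.mono_left nhdsWithin_le_nhds
    obtain ⟨t, ht, htpos⟩ := ((htend.eventually (h ε hε)).and self_mem_nhdsWithin).exists
    have htpos : 0 < t := htpos
    rw [add_sub_cancel_left, inner_smul_right, norm_smul, Real.norm_of_nonneg htpos.le] at ht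
    refine le_of_mul_le_mul_left ?_ htpos
    linarith
  have hlim : Tendsto (fun ε : ℝ => ε * ‖u‖) (𝓝[>] 0) (𝓝 0) := by
    have : Tendsto (fun ε : ℝ => ε * ‖u‖) (𝓝 0) (𝓝 (0 * ‖u‖)) :=
      Continuous.tendsto (by fun_prop) 0
    simpa using this.mono_left nhdsWithin_le_nhds
  exact ge_of_tendsto hlim (eventually_nhdsWithin_of_forall fun ε hε => key ε hε)

/-- A global subgradient inequality yields a limiting subgradient. -/
theorem mem_subdifferential_of_forall_le {m : ℕ} {θ : Vec m → EReal} {z v : Vec m} {α : ℝ}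
    (hz : θ z = α) (h : ∀ y (β : ℝ), θ y ≤ β → α + inner ℝ v (y - z) ≤ β) :
    v ∈ subdifferential θ z := by
  -- Constant sequences suffice: the global inequality makes `(v, -1)` a regular normal at the base
  -- point itself.
  refine ⟨by simp [hz], by simp [hz], by simp [epigraph, hz], fun _ => _, fun _ => _,
    tendsto_const_nhds, tendsto_const_nhds, fun _ => ⟨by simp [epigraph, hz], ?_⟩⟩
  intro ε hε
  filter_upwards [self_mem_nhdsWithin] with q hq
  have := h q.fst q.snd hq
  have h2 : 0 ≤ ε * ‖q - WithLp.toLp 2 (z, (θ z).toReal)‖ := by positivity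
  refine le_trans ?_ h2
  simp only [WithLp.prod_inner_apply, hz, EReal.toReal_coe]
  simp
  linarith

/-! ### Pairs and the outer function in coordinates -/

/-- The identification of pairs with vectors of `l + r` coordinates. -/
noncomputable def pairEquiv (l r : ℕ) : (Vec l × Vec r) ≃L[ℝ] Vec (l + r) :=
  LinearEquiv.toContinuousLinearEquiv
    { toFun := fun y => pair y.1 y.2
      invFun := fun z => (WithLp.toLp 2 fun i => z (Fin.castAdd r i),
        WithLp.toLp 2 fun j => z (Fin.natAdd l j))
      map_add' := by
        intro a b
        ext i
        refine Fin.addCases (fun i => ?_) (fun i => ?_) i <;> simp [pair]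
      map_smul' := by
        intro a b
        ext i
        refine Fin.addCases (fun i => ?_) (fun i => ?_) i <;> simp [pair]
      left_inv := by
        intro a
        ext i <;> simp [pair]
      right_inv := by
        intro a
        ext i
        refine Fin.addCases (fun i => ?_) (fun i => ?_) i <;> simp [pair] }

@[simp]
theorem pairEquiv_apply {l r : ℕ} (y : Vec l × Vec r) : pairEquiv l r y = pair y.1 y.2 := rfl

theorem inner_pair {l r : ℕ} (a b : Vec l) (a' b' : Vec r) :
    inner ℝ (pair a a') (pair b b') = inner ℝ a b + inner ℝ a' b' := by
  simp [pair, PiLp.inner_apply, Fin.sum_univ_add]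

theorem finMax_le_iff {l : ℕ} [NeZero l] {f : Fin l → ℝ} {a : ℝ} :
    finMax f ≤ a ↔ ∀ i, f i ≤ a := by
  simp [finMax]

theorem le_finMax {l : ℕ} [NeZero l] (f : Fin l → ℝ) (i : Fin l) : f i ≤ finMax f :=
  finMax_le_iff.1 le_rfl i

theorem minimaxOuter_pair {l r p : ℕ} [NeZero l] (c : Fin p → Vec r) (τ : Fin p → ℝ)
    (a : Vec l) (b : Vec r) :
    minimaxOuter c τ (pair a b) = (finMax (fun i => a i) : EReal) +
      indicatorFn (polyhedron c τ) b := by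
  have h : pair a b ∈ polyhedron (fun t => pair (0 : Vec l) (c t)) τ ↔ b ∈ polyhedron c τ := by
    simp [polyhedron, inner_pair]
  have hm : (fun i : Fin l => inner ℝ (pair (EuclideanSpace.single i (1 : ℝ)) (0 : Vec r))
      (pair a b)) = fun i => a i := by
    simp [inner_pair, EuclideanSpace.inner_single_left]
  rw [minimaxOuter, hm]
  by_cases hb : b ∈ polyhedron c τ
  · rw [indicatorFn, indicatorFn, if_pos (h.2 hb), if_pos hb]
  · rw [indicatorFn, indicatorFn, if_neg (mt h.1 hb), if_neg hb]

theorem minimaxOuter_pair_le_iff {l r p : ℕ} [NeZero l] (c : Fin p → Vec r) (τ : Fin p → ℝ)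
    (a : Vec l) (b : Vec r) (α : ℝ) :
    minimaxOuter c τ (pair a b) ≤ α ↔ (∀ i, a i ≤ α) ∧ b ∈ polyhedron c τ := by
  rw [minimaxOuter_pair, indicatorFn]
  split_ifs with h
  · simp [h, finMax_le_iff]
  · simp [h]

theorem minimaxOuter_pair_eq {l r p : ℕ} [NeZero l] {c : Fin p → Vec r} {τ : Fin p → ℝ}
    (a : Vec l) {b : Vec r} (hb : b ∈ polyhedron c τ) :
    minimaxOuter c τ (pair a b) = (finMax (fun i => a i) : ℝ) := by
  simp [minimaxOuter_pair, indicatorFn, hb]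

theorem activeMax_nonempty {l : ℕ} [NeZero l] (a : Vec l) : (activeMax a).Nonempty := by
  obtain ⟨i, -, hi⟩ := Finset.exists_mem_eq_sup' (s := (Finset.univ : Finset (Fin l)))
    Finset.univ_nonempty (fun j => a j)
  exact ⟨i, hi⟩

/-! ### The subdifferential of the outer function -/

/-- The span of the differences of unit vectors over the active indices of the maximum. -/
def maxSpan {l : ℕ} [NeZero l] (a : Vec l) : Submodule ℝ (Vec l) :=
  Submodule.span ℝ {u : Vec l | ∃ i ∈ activeMax a, ∃ j ∈ activeMax a,
    u = EuclideanSpace.single i (1 : ℝ) - EuclideanSpace.single j (1 : ℝ)}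

/-- The span of the active constraint vectors. -/
def constraintSpan {r p : ℕ} (c : Fin p → Vec r) (τ : Fin p → ℝ) (b : Vec r) :
    Submodule ℝ (Vec r) :=
  Submodule.span ℝ {u : Vec r | ∃ t ∈ activeConstraints c τ b, u = c t}

/-- The maximum dominates its `i`-th coordinate, with equality at `a` since `i` is active, and `hu`
makes `u` a convex normal to the polyhedron at `b`. Adding the two inequalities gives a global
subgradient inequality. -/
theorem pair_single_mem_subdifferential {l r p : ℕ} [NeZero l] {c : Fin p → Vec r}
    {τ : Fin p → ℝ} {a : Vec l} {b : Vec r} (hb : b ∈ polyhedron c τ) {i : Fin l}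
    (hi : i ∈ activeMax a) {u : Vec r} (hu : ∀ b' ∈ polyhedron c τ, inner ℝ u (b' - b) ≤ 0) :
    pair (EuclideanSpace.single i (1 : ℝ)) u ∈
      subdifferential (minimaxOuter (l := l) c τ) (pair a b) := by
  refine mem_subdifferential_of_forall_le (minimaxOuter_pair_eq a hb) ?_
  intro y β hy
  obtain ⟨⟨a', b'⟩, rfl⟩ := (pairEquiv l r).surjective y
  obtain ⟨h1, h2⟩ := (minimaxOuter_pair_le_iff c τ a' b' β).1 hy
  have hsub : pairEquiv l r (a', b') - pair a b = pair (a' - a) (b' - b) :=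
    (map_sub (pairEquiv l r) (a', b') (a, b)).symm
  have hi : finMax (fun j => a j) = a i := hi
  have := hu b' h2
  have := h1 i
  rw [hsub, inner_pair, EuclideanSpace.inner_single_left, hi]
  simp
  linarith

theorem mem_epigraph_minimaxOuter_iff {l r p : ℕ} [NeZero l] {c : Fin p → Vec r} {τ : Fin p → ℝ}
    {q : WithLp 2 (Vec (l + r) × ℝ)} :
    q ∈ epigraph (minimaxOuter (l := l) c τ) ↔ (∀ i, q.fst (Fin.castAdd r i) ≤ q.snd) ∧
      ∀ t, inner ℝ (pair (0 : Vec l) (c t)) q.fst ≤ τ t := by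
  obtain ⟨⟨a, b⟩, h⟩ := (pairEquiv l r).surjective q.fst
  change minimaxOuter c τ q.fst ≤ q.snd ↔ _
  rw [← h, pairEquiv_apply, minimaxOuter_pair_le_iff]
  simp only [inner_pair, inner_zero_left, zero_add]
  simp [pair, polyhedron]

/-- The epigraph of the outer function is locally invariant along the directions in which the
outer function is affine near the point. -/
theorem eventually_add_smul_mem_epigraph {l r p : ℕ} [NeZero l] {c : Fin p → Vec r}
    {τ : Fin p → ℝ} {a : Vec l} {b : Vec r} (hb : b ∈ polyhedron c τ) {u₁ : Vec l} {u₂ : Vec r}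
    {κ : ℝ} (h₁ : ∀ i ∈ activeMax a, u₁ i = κ)
    (h₂ : ∀ t ∈ activeConstraints c τ b, inner ℝ (c t) u₂ = 0) (σ : ℝ) :
    ∀ᶠ q in 𝓝 (WithLp.toLp 2 (pair a b, finMax fun i => a i)),
      q ∈ epigraph (minimaxOuter (l := l) c τ) →
      ∀ᶠ t : ℝ in 𝓝[>] 0, q + t • (σ • WithLp.toLp 2 (pair u₁ u₂, κ)) ∈
        epigraph (minimaxOuter (l := l) c τ) := by
  have hA : ∀ i, ∀ᶠ q : WithLp 2 (Vec (l + r) × ℝ) in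
      𝓝 (WithLp.toLp 2 (pair a b, finMax fun i => a i)),
      i ∉ activeMax a → q.fst (Fin.castAdd r i) < q.snd := by
    intro i
    by_cases hi : i ∈ activeMax a
    · simp [hi]
    have hlt : a i < finMax fun j => a j := 
      lt_of_le_of_ne (le_finMax (fun j => a j) i) fun h => hi h.symm
    have := ContinuousAt.eventually_lt
      (f := fun q : WithLp 2 (Vec (l + r) × ℝ) => q.fst (Fin.castAdd r i))
      (g := fun q => q.snd) (x₀ := WithLp.toLp 2 (pair a b, finMax fun i => a i))
      (Continuous.continuousAt (by fun_prop)) (Continuous.continuousAt (by fun_prop))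
      (by simpa [pair] using hlt)
    exact this.mono fun q hq _ => hq
  have hC : ∀ t, ∀ᶠ q : WithLp 2 (Vec (l + r) × ℝ) in
      𝓝 (WithLp.toLp 2 (pair a b, finMax fun i => a i)),
      t ∉ activeConstraints c τ b → inner ℝ (pair (0 : Vec l) (c t)) q.fst < τ t := by
    intro t
    by_cases ht : t ∈ activeConstraints c τ b
    · simp [ht]
    have hlt : inner ℝ (c t) b < τ t := lt_of_le_of_ne (hb t) ht
    have := ContinuousAt.eventually_lt
      (f := fun q : WithLp 2 (Vec (l + r) × ℝ) => inner ℝ (pair (0 : Vec l) (c t)) q.fst)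
      (g := fun _ => τ t) (x₀ := WithLp.toLp 2 (pair a b, finMax fun i => a i))
      (Continuous.continuousAt (by fun_prop)) continuousAt_const
      (by simpa [inner_pair] using hlt)
    exact this.mono fun q hq _ => hq
  -- Constraints inactive at the base point are strict at the nearby `q`, hence survive a small step
  -- whose size may depend on `q`.
  filter_upwards [eventually_all.2 hA, eventually_all.2 hC] with q hqA hqC hq
  obtain ⟨hq₁, hq₂⟩ := mem_epigraph_minimaxOuter_iff.1 hq
  simp only [mem_epigraph_minimaxOuter_iff, eventually_and, eventually_all]
  have heq : ∀ i, (pair u₁ u₂) (Fin.castAdd r i) = u₁ i := by simp [pair]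
  refine ⟨fun i => ?_, fun t => ?_⟩
  · by_cases hi : i ∈ activeMax a
    -- Here the coordinate and the height shift by the same amount, so a step of any size and sign
    -- is harmless.
    · refine Eventually.of_forall fun s => ?_
      have := hq₁ i
      simp [heq, h₁ i hi, this]
    · have := ContinuousAt.eventually_lt
        (f := fun s : ℝ => (q + s • (σ • WithLp.toLp 2 (pair u₁ u₂, κ))).fst (Fin.castAdd r i))
        (g := fun s => (q + s • (σ • WithLp.toLp 2 (pair u₁ u₂, κ))).snd) (x₀ := 0)
        (Continuous.continuousAt (by fun_prop)) (Continuous.continuousAt (by fun_prop))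
        (by simpa using hqA i hi)
      exact nhdsWithin_le_nhds (this.mono fun s hs => hs.le)
  · by_cases ht : t ∈ activeConstraints c τ b
    · refine Eventually.of_forall fun s => ?_
      have := hq₂ t
      simp [inner_add_right, inner_smul_right, inner_pair, h₂ t ht, this]
    · have := ContinuousAt.eventually_lt
        (f := fun s : ℝ => inner ℝ (pair (0 : Vec l) (c t))
          (q + s • (σ • WithLp.toLp 2 (pair u₁ u₂, κ))).fst)
        (g := fun _ => τ t) (x₀ := 0)
        (Continuous.continuousAt (by fun_prop)) continuousAt_const
        (by simpa using hqC t ht)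
      exact nhdsWithin_le_nhds (this.mono fun s hs => hs.le)

/-- Limiting subgradients of the outer function are orthogonal to the directions along which it is
affine near the point. -/
theorem inner_eq_of_mem_subdifferential {l r p : ℕ} [NeZero l] {c : Fin p → Vec r}
    {τ : Fin p → ℝ} {a : Vec l} {b : Vec r} {v : Vec (l + r)}
    (hv : v ∈ subdifferential (minimaxOuter (l := l) c τ) (pair a b)) {u₁ : Vec l} {u₂ : Vec r}
    {κ : ℝ} (h₁ : ∀ i ∈ activeMax a, u₁ i = κ)
    (h₂ : ∀ t ∈ activeConstraints c τ b, inner ℝ (c t) u₂ = 0) :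
    inner ℝ v (pair u₁ u₂) = κ := by
  obtain ⟨-, -, hepi, xs, vs, hxs, hvs, hk⟩ := hv
  have hb : b ∈ polyhedron c τ := by
    by_contra hb
    have h0 := hepi
    simp only [epigraph, Set.mem_ofPred_eq] at h0
    exact hb ((minimaxOuter_pair_le_iff c τ a b _).1 h0).2
  rw [minimaxOuter_pair_eq a hb, EReal.toReal_coe] at hxs
  set w : WithLp 2 (Vec (l + r) × ℝ) := WithLp.toLp 2 (pair u₁ u₂, κ) with hw
  have hlocal := eventually_add_smul_mem_epigraph hb h₁ h₂
  have hzero : ∀ᶠ k in atTop, inner ℝ (vs k) w = 0 := by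
    -- Both `σ = 1` and `σ = -1` are admissible, so two opposite inequalities force orthogonality.
    filter_upwards [hxs.eventually (hlocal 1), hxs.eventually (hlocal (-1))] with k hp hm
    have h1 := (hk k).2.inner_nonpos (hp (hk k).1)
    have h2 := (hk k).2.inner_nonpos (hm (hk k).1)
    simp only [inner_smul_right] at h1 h2
    linarith
  have hlim : inner ℝ (WithLp.toLp 2 (v, (-1 : ℝ))) w = 0 :=
    tendsto_nhds_unique (hvs.inner tendsto_const_nhds)
      (tendsto_const_nhds.congr' (hzero.mono fun k hk => hk.symm))
  simp [hw, WithLp.prod_inner_apply] at hlim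
  linarith

theorem parallelSubspace_minimaxOuter {l r p : ℕ} [NeZero l] {c : Fin p → Vec r}
    {τ : Fin p → ℝ} (a : Vec l) {b : Vec r} (hb : b ∈ polyhedron c τ) :
    parallelSubspace (minimaxOuter (l := l) c τ) (pair a b) =
      ((maxSpan a).prod (constraintSpan c τ b)).map
        ((pairEquiv l r).toLinearEquiv : (Vec l × Vec r) →ₗ[ℝ] Vec (l + r)) := by
  obtain ⟨i₀, hi₀⟩ := activeMax_nonempty a
  have hmem : ∀ i ∈ activeMax a, pair (EuclideanSpace.single i (1 : ℝ)) 0 ∈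
      subdifferential (minimaxOuter (l := l) c τ) (pair a b) := fun i hi =>
    pair_single_mem_subdifferential hb hi (by simp)
  rw [parallelSubspace, direction_affineSpan]
  apply le_antisymm
  · rw [vectorSpan_eq_span_vsub_set_right ℝ (hmem i₀ hi₀), Submodule.span_le]
    rintro _ ⟨v, hv, rfl⟩
    obtain ⟨⟨v₁, v₂⟩, rfl⟩ := (pairEquiv l r).surjective v
    -- The subgradient `(e_{i₀}, 0)` serves as base point of the affine hull.
    refine ⟨(v₁ - EuclideanSpace.single i₀ 1, v₂), ?_, ?_⟩
    swap
    · simpa using map_sub (pairEquiv l r) (v₁, v₂) (EuclideanSpace.single i₀ 1, 0)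
    constructor
    · rw [← Submodule.orthogonal_orthogonal (maxSpan a)]
      intro u hu
      -- Orthogonality of `u` to all `eᵢ - e_{i₀}` says that `u` is constant, equal to `u i₀`, on
      -- the active indices.
      have h := inner_eq_of_mem_subdifferential hv (u₁ := u) (u₂ := 0) (κ := u i₀) (by
        intro i hi
        have := hu _ (Submodule.subset_span ⟨i, hi, i₀, hi₀, rfl⟩)
        rw [inner_sub_left, EuclideanSpace.inner_single_left,
          EuclideanSpace.inner_single_left] at this
        simp at this
        linarith) (by simp)
      rw [pairEquiv_apply, inner_pair] at h
      rw [real_inner_comm, inner_sub_left, EuclideanSpace.inner_single_left]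
      simp at h ⊢
      linarith
    · change v₂ ∈ constraintSpan c τ b
      rw [← Submodule.orthogonal_orthogonal (constraintSpan c τ b)]
      intro u hu
      have h := inner_eq_of_mem_subdifferential hv (u₁ := 0) (u₂ := u) (κ := 0) (by simp)
        fun t ht => hu _ (Submodule.subset_span ⟨t, ht, rfl⟩)
      rw [pairEquiv_apply, inner_pair] at h
      rw [real_inner_comm]
      simpa using h
  · rw [Submodule.map_le_iff_le_comap]
    rintro ⟨y₁, y₂⟩ ⟨hy₁, hy₂⟩
    set V := vectorSpan ℝ (subdifferential (minimaxOuter (l := l) c τ) (pair a b))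
    have h₁ : pairEquiv l r (y₁, 0) ∈ V := by
      change y₁ ∈ V.comap (((pairEquiv l r).toLinearEquiv : (Vec l × Vec r) →ₗ[ℝ] Vec (l + r)) ∘ₗ
        LinearMap.inl ℝ (Vec l) (Vec r))
      refine Submodule.span_le.2 ?_ hy₁
      rintro _ ⟨i, hi, j, hj, rfl⟩
      have e := map_sub (pairEquiv l r) (EuclideanSpace.single i 1, 0)
        (EuclideanSpace.single j 1, 0)
      simp only [Prod.mk_sub_mk, sub_zero] at e
      change pairEquiv l r (_, 0) ∈ V
      exact e ▸ vsub_mem_vectorSpan ℝ (hmem i hi) (hmem j hj)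
    have h₂ : pairEquiv l r (0, y₂) ∈ V := by
      change y₂ ∈ V.comap (((pairEquiv l r).toLinearEquiv : (Vec l × Vec r) →ₗ[ℝ] Vec (l + r)) ∘ₗ
        LinearMap.inr ℝ (Vec l) (Vec r))
      refine Submodule.span_le.2 ?_ hy₂
      rintro _ ⟨t, ht, rfl⟩
      have e := map_sub (pairEquiv l r) (EuclideanSpace.single i₀ 1, c t)
        (EuclideanSpace.single i₀ 1, 0)
      simp only [Prod.mk_sub_mk, sub_zero, sub_self] at e
      change pairEquiv l r (0, _) ∈ V
      -- An active `c t` is normal to the polyhedron at `b`, so `(e_{i₀}, c t)` is a subgradient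
      -- too.
      refine e ▸ vsub_mem_vectorSpan ℝ (pair_single_mem_subdifferential hb hi₀ ?_) (hmem i₀ hi₀)
      intro b' hb'
      have h1 : inner ℝ (c t) b = τ t := ht
      have h2 := hb' t
      rw [inner_sub_right]
      linarith
    have e := map_add (pairEquiv l r) (y₁, 0) (0, y₂)
    rw [Prod.mk_add_mk, add_zero, zero_add] at e
    change pairEquiv l r (y₁, y₂) ∈ V
    exact e ▸ add_mem h₁ h₂

/-! ### Reduction matrices -/

/-- An orthonormal basis of `S` extends to one of the whole space with the vectors of `S` listed
first; these are the columns of `A`. -/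
theorem exists_isReductionMatrix {m : ℕ} (θ : Vec m → EReal) (z : Vec m) :
    ∃ B, IsReductionMatrix θ z B := by
  set S := parallelSubspace θ z
  have hs : Module.finrank ℝ S ≤ m := by simpa using S.finrank_le
  let f := stdOrthonormalBasis ℝ S
  let g : Fin m → Vec m := fun i => if h : (i : ℕ) < Module.finrank ℝ S then f ⟨i, h⟩ else 0
  have hg : Orthonormal ℝ (Set.domRestrict {i : Fin m | (i : ℕ) < Module.finrank ℝ S} g) := by
    have h0 : Set.domRestrict {i : Fin m | (i : ℕ) < Module.finrank ℝ S} g =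
        fun i => (S.subtypeₗᵢ (f ⟨i.1, i.2⟩) : Vec m) := by
      funext i
      have : (i.1 : ℕ) < Module.finrank ℝ S := i.2
      simp [g, Set.domRestrict, this]
    rw [h0]
    refine (f.orthonormal.comp_linearIsometry S.subtypeₗᵢ).comp
      (fun i : {i : Fin m | (i : ℕ) < Module.finrank ℝ S} => ⟨i.1, i.2⟩) ?_
    intro i j hij
    ext
    simpa using hij
  obtain ⟨b, hb⟩ := hg.exists_orthonormalBasis_extension_of_card_eq (by simp)
  have hbS : ∀ i : Fin m, (i : ℕ) < Module.finrank ℝ S → b i ∈ S := by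
    intro i hi
    rw [hb i hi]
    simp [g, hi]
  let A : Matrix (Fin m) (Fin m) ℝ := Matrix.of fun i j => b j i
  have hAt : ∀ y i, Matrix.toEuclideanLin A.transpose y i = inner ℝ (b i) y := by
    intro y i
    simp [A, Matrix.toLpLin_apply, Matrix.mulVec, dotProduct, PiLp.inner_apply, mul_comm]
  refine ⟨_, A, hs, ?_, ?_, rfl⟩
  · rw [Matrix.mem_orthogonalGroup_iff']
    ext i j
    have := orthonormal_iff_ite.1 b.orthonormal i j
    simp only [PiLp.inner_apply] at this
    simpa [A, Matrix.mul_apply, Matrix.star_eq_conjTranspose, Matrix.one_apply, mul_comm] using this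
  · have hle : (leadingCoordinates m (Module.finrank ℝ S)) ≤
        S.map (Matrix.toEuclideanLin A.transpose) := by
      intro y hy
      refine ⟨∑ i, y i • b i, ?_, ?_⟩
      · refine Submodule.sum_mem _ fun i _ => ?_
        by_cases hi : (i : ℕ) < Module.finrank ℝ S
        · exact S.smul_mem _ (hbS i hi)
        · simp [hy i (not_lt.1 hi)]
      · ext i
        rw [hAt, b.orthonormal.inner_right_fintype]
    refine le_antisymm ?_ hle
    rintro _ ⟨y, hy, rfl⟩ i hi
    have hsum : y = ∑ k, f.repr ⟨y, hy⟩ k • (f k : Vec m) := by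
      simpa using congrArg (S.subtype) (f.sum_repr ⟨y, hy⟩).symm
    rw [hAt, hsum, inner_sum]
    refine Finset.sum_eq_zero fun k _ => ?_
    have hk : (f k : Vec m) = b (Fin.castLE hs k) := by
      rw [hb _ (by simp)]
      simp [g]
    have hne : i ≠ Fin.castLE hs k := by
      rintro rfl
      exact absurd k.2 (not_lt.2 hi)
    rw [hk, inner_smul_right, b.orthonormal.2 hne, mul_zero]

/-- The isometry `Aᵀ = A⁻¹` carries `S` onto the leading coordinates, and `B` reads off just those
coordinates of `Aᵀ y`. They vanish exactly when `y` is orthogonal to `S`, whichever `A` is chosen.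
-/
theorem ker_reductionMatrix {m : ℕ} {θ : Vec m → EReal} {z : Vec m}
    {B : Matrix (Fin (Module.finrank ℝ (parallelSubspace θ z))) (Fin m) ℝ}
    (hB : IsReductionMatrix θ z B) :
    LinearMap.ker (Matrix.toEuclideanLin B) = (parallelSubspace θ z)ᗮ := by
  obtain ⟨A, hs, hA, hmap, rfl⟩ := hB
  have hinv : A⁻¹ = A.transpose := by
    apply Matrix.inv_eq_left_inv
    have := (Matrix.mem_orthogonalGroup_iff' (Fin m) ℝ).1 hA
    simpa [Matrix.star_eq_conjTranspose] using this
  have hrow : ∀ y i, Matrix.toEuclideanLin (A⁻¹.submatrix (Fin.castLE hs) id) y i =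
      Matrix.toEuclideanLin A.transpose y (Fin.castLE hs i) := by
    intro y i
    simp [hinv, Matrix.toLpLin_apply, Matrix.mulVec, dotProduct]
  have hinner : ∀ x y, inner ℝ (Matrix.toEuclideanLin A.transpose x)
      (Matrix.toEuclideanLin A.transpose y) = inner ℝ x y := by
    intro x y
    have h1 := (Matrix.mem_orthogonalGroup_iff (Fin m) ℝ).1 hA
    have h2 : (A.transpose.mulVec x.ofLp) ⬝ᵥ (A.transpose.mulVec y.ofLp) =
        x.ofLp ⬝ᵥ y.ofLp := by
      rw [Matrix.dotProduct_mulVec, Matrix.vecMul_transpose, Matrix.mulVec_mulVec]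
      have : A * A.transpose = 1 := by simpa [Matrix.star_eq_conjTranspose] using h1
      simp [this]
    simpa [Matrix.toLpLin_apply, PiLp.inner_apply, dotProduct, mul_comm] using h2
  ext y
  rw [LinearMap.mem_ker, Submodule.mem_orthogonal]
  constructor
  · intro hy u hu
    have hu' : Matrix.toEuclideanLin A.transpose u ∈ leadingCoordinates m _ :=
      hmap ▸ Submodule.mem_map_of_mem hu
    rw [← hinner, PiLp.inner_apply]
    refine Finset.sum_eq_zero fun i _ => ?_
    by_cases hi : (i : ℕ) < Module.finrank ℝ (parallelSubspace θ z)
    · have := hrow y ⟨i, hi⟩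
      rw [hy] at this
      have h0 : Matrix.toEuclideanLin A.transpose y i = 0 := this.symm
      rw [h0, inner_zero_right]
    · rw [hu' i (not_lt.1 hi), inner_zero_left]
  · intro hy
    ext i
    rw [hrow]
    -- The `i`-th unit vector is the image of some `u ∈ S`; testing `y` against that `u` isolates
    -- the coordinate.
    have hmem : EuclideanSpace.single (Fin.castLE hs i) (1 : ℝ) ∈
        leadingCoordinates m (Module.finrank ℝ (parallelSubspace θ z)) := by
      intro j hj
      have : j ≠ Fin.castLE hs i := by
        rintro rfl
        exact absurd i.2 (not_lt.2 hj)
      simp [this]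
    rw [← hmap] at hmem
    obtain ⟨u, hu, hu'⟩ := hmem
    have := hy u hu
    rw [← hinner, hu', EuclideanSpace.inner_single_left] at this
    simpa using this

/-! ### Duality and the adjoint kernel -/

/-- A range and an orthogonal complement span the space when the kernel of the adjoint meets
the subspace trivially. -/
theorem range_sup_orthogonal_eq_top_iff {E F : Type*} [NormedAddCommGroup E]
    [InnerProductSpace ℝ E] [FiniteDimensional ℝ E] [NormedAddCommGroup F]
    [InnerProductSpace ℝ F] [FiniteDimensional ℝ F] (T : E →L[ℝ] F) (S : Submodule ℝ F) :
    LinearMap.range (T : E →ₗ[ℝ] F) ⊔ Sᗮ = ⊤ ↔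
      ∀ y ∈ S, (∀ x, inner ℝ (T x) y = 0) → y = 0 := by
  rw [← Submodule.orthogonal_eq_bot_iff, ← Submodule.inf_orthogonal,
    Submodule.orthogonal_orthogonal, Submodule.eq_bot_iff]
  constructor
  · intro h y hy hT
    refine h y ⟨?_, hy⟩
    rintro _ ⟨x, rfl⟩
    exact hT x
  · rintro h y ⟨hT, hy⟩
    exact h y hy fun x => hT _ ⟨x, rfl⟩

theorem contDiffAt_slice_differentiableAt {n d : ℕ} {f : Vec n → Vec d → ℝ} {x : Vec n} {w : Vec d}
    (h : ContDiffAt ℝ 2 (fun q : Vec n × Vec d => f q.1 q.2) (x, w)) :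
    DifferentiableAt ℝ (fun u => f u w) x :=
  DifferentiableAt.comp x (h.differentiableAt (by norm_num))
    (f := fun u : Vec n => (u, w)) (by fun_prop)

theorem differentiableAt_stack {n d k : ℕ} {f : Fin k → Vec n → Vec d → ℝ} {x : Vec n} {w : Vec d}
    (h : ∀ i, ContDiffAt ℝ 2 (fun q : Vec n × Vec d => f i q.1 q.2) (x, w)) :
    DifferentiableAt ℝ (fun u => stack f u w) x :=
  differentiableAt_euclidean.2 fun i => contDiffAt_slice_differentiableAt (h i)
theorem inner_partialFDeriv_minimaxInner {n d l r : ℕ} {φ : Fin l → Vec n → Vec d → ℝ}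
    {ζ : Fin r → Vec n → Vec d → ℝ} {x : Vec n} {w : Vec d}
    (hφ : DifferentiableAt ℝ (fun u => stack φ u w) x)
    (hζ : DifferentiableAt ℝ (fun u => stack ζ u w) x) (u : Vec n) (y₁ : Vec l) (y₂ : Vec r) :
    inner ℝ (partialFDeriv (minimaxInner φ ζ) x w u) (pair y₁ y₂) =
      inner ℝ u (ContinuousLinearMap.adjoint (partialFDeriv (stack φ) x w) y₁ +
        ContinuousLinearMap.adjoint (partialFDeriv (stack ζ) x w) y₂) := by
  have h : partialFDeriv (minimaxInner φ ζ) x w =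
      ((pairEquiv l r : (Vec l × Vec r) →L[ℝ] Vec (l + r)).comp
        ((partialFDeriv (stack φ) x w).prod (partialFDeriv (stack ζ) x w))) :=
    ((pairEquiv l r).hasFDerivAt.comp x (hφ.hasFDerivAt.prodMk hζ.hasFDerivAt)).fderiv
  rw [h, inner_add_right, ContinuousLinearMap.adjoint_inner_right,
    ContinuousLinearMap.adjoint_inner_right, ← inner_pair]
  rfl

end MinimaxND

theorem mainTheorem9 {n d l r p : ℕ} [NeZero l]
    (φ : Fin l → Vec n → Vec d → ℝ) (ζ : Fin r → Vec n → Vec d → ℝ)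
    (c : Fin p → Vec r) (τ : Fin p → ℝ)
    (xbar : Vec n) (wbar : Vec d)
    (hφ : ∀ i, ContDiffAt ℝ 2 (fun q : Vec n × Vec d => φ i q.1 q.2) (xbar, wbar))
    (hζ : ∀ j, ContDiffAt ℝ 2 (fun q : Vec n × Vec d => ζ j q.1 q.2) (xbar, wbar))
    (hfeas : stack ζ xbar wbar ∈ polyhedron c τ) :
    (∃ B, IsReductionMatrix (minimaxOuter (l := l) c τ) (minimaxInner φ ζ xbar wbar) B) ∧
    ∀ B, IsReductionMatrix (minimaxOuter (l := l) c τ) (minimaxInner φ ζ xbar wbar) B →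
      (IsPartialNondegenerate (minimaxInner φ ζ) (fun z => Matrix.toEuclideanLin B z) xbar wbar ↔
        activeSpan c τ (stack φ xbar wbar) (stack ζ xbar wbar) ∩
          adjointKernel (stack φ) (stack ζ) xbar wbar = {0}) := by
  refine ⟨exists_isReductionMatrix _ _, fun B hB => ?_⟩
  have hder : (fderiv ℝ (fun z => Matrix.toEuclideanLin B z) (minimaxInner φ ζ xbar wbar) :
      Vec (l + r) →ₗ[ℝ] Vec _) = Matrix.toEuclideanLin B := by
    have := (Matrix.toEuclideanLin B).toContinuousLinearMap.fderiv
      (x := minimaxInner φ ζ xbar wbar)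
    exact congrArg ContinuousLinearMap.toLinearMap this
  rw [IsPartialNondegenerate, hder, ker_reductionMatrix hB, range_sup_orthogonal_eq_top_iff]
  have hspan : ∀ y₁ y₂, pair y₁ y₂ ∈ parallelSubspace (minimaxOuter (l := l) c τ)
      (minimaxInner φ ζ xbar wbar) ↔
        (y₁, y₂) ∈ activeSpan c τ (stack φ xbar wbar) (stack ζ xbar wbar) := by
    intro y₁ y₂
    rw [minimaxInner, parallelSubspace_minimaxOuter _ hfeas]
    refine ⟨?_, fun h => ⟨(y₁, y₂), h, rfl⟩⟩
    rintro ⟨y, hy, he⟩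
    have : y = (y₁, y₂) := (pairEquiv l r).injective he
    exact this ▸ hy
  have hker : ∀ y₁ y₂, (∀ u, inner ℝ (partialFDeriv (minimaxInner φ ζ) xbar wbar u)
      (pair y₁ y₂) = 0) ↔ (y₁, y₂) ∈ adjointKernel (stack φ) (stack ζ) xbar wbar := by
    intro y₁ y₂
    simp only [inner_partialFDeriv_minimaxInner (differentiableAt_stack hφ)
      (differentiableAt_stack hζ)]
    -- The test vector `u` is the sum of adjoint images itself.
    exact ⟨fun h => inner_self_eq_zero.1 (h _), fun h u => by
      rw [show _ + _ = (0 : Vec n) from h, inner_zero_right]⟩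
  rw [Set.eq_singleton_iff_unique_mem]
  constructor
  · intro h
    refine ⟨⟨(hspan 0 0).1 ?_, (hker 0 0).1 ?_⟩, ?_⟩
    · rw [show pair (0 : Vec l) (0 : Vec r) = 0 from map_zero (pairEquiv l r)]
      exact zero_mem _
    · rw [show pair (0 : Vec l) (0 : Vec r) = 0 from map_zero (pairEquiv l r)]
      exact fun u => inner_zero_right _
    · rintro ⟨y₁, y₂⟩ ⟨hS, hK⟩
      have := h _ ((hspan y₁ y₂).2 hS) ((hker y₁ y₂).2 hK)
      exact (pairEquiv l r).map_eq_zero_iff.1 this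
  · rintro ⟨-, h⟩ y hS hK
    obtain ⟨⟨y₁, y₂⟩, rfl⟩ := (pairEquiv l r).surjective y
    exact (pairEquiv l r).map_eq_zero_iff.2 (h _ ⟨(hspan y₁ y₂).1 hS, (hker y₁ y₂).1 hK⟩)
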